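/- Let $b_1,b_2,c_1,c_2,h_1,h_2$ be positive real numbers, and consider the normalized Leslie–Gower system with immigration $$ x_{n+1}=\frac{b_1x_n}{1+x_n+c_1y_n}+h_1,\qquad y_{n+1}=\frac{b_2y_n}{1+y_n+c_2x_n}+h_2,\qquad n=0,1,2,\ldots,\quad (x_0,y_0)\in[0,\infty)^2. \tag{LGIN} $$ An equilibrium of (LGIN) in $[0,\infty)^2$ is a point $(x,y)\in[0,\infty)^2$ that is fixed by the map $$T(x,y)=\left(\frac{b_1x}{1+x+c_1y}+h_1,\ \frac{b_2y}{1+y+c_2x}+h_2\right).$$ If at least one of the following conditions holds: (a) $1-b_1+h_1+c_1h_2\ge 0$ and $1-b_2+h_2+c_2h_1\ge 0$; (b) $c_1c_2\le 1$; then (LGIN) has exactly one equilibrium in $[0,\infty)^2$. -/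

import Mathlib

/-- The right-hand side of the normalized Leslie-Gower system with immigration
`x' = b₁ x / (1 + x + c₁ y) + h₁`, `y' = b₂ y / (1 + y + c₂ x) + h₂`.
For nonnegative `c₁, c₂` the denominators are positive on `[0,∞)²`. -/
noncomputable def LGINMap (b₁ b₂ c₁ c₂ h₁ h₂ : ℝ) (p : ℝ × ℝ) : ℝ × ℝ :=
  (b₁ * p.1 / (1 + p.1 + c₁ * p.2) + h₁, b₂ * p.2 / (1 + p.2 + c₂ * p.1) + h₂)

/-- An equilibrium of the system in `[0,∞)²`: a fixed point of its map lying there. -/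
def IsLGINEquilibrium (b₁ b₂ c₁ c₂ h₁ h₂ : ℝ) (p : ℝ × ℝ) : Prop :=
  p ∈ Set.Ici (0 : ℝ) ×ˢ Set.Ici (0 : ℝ) ∧
    Function.IsFixedPt (LGINMap b₁ b₂ c₁ c₂ h₁ h₂) p

/-- In the coordinates `u = x - h₁`, `v = y - h₂` the equilibria are the positive solutions of a
pair of quadratic equations. -/
theorem isLGINEquilibrium_iff {b₁ b₂ c₁ c₂ h₁ h₂ : ℝ} (hb₁ : 0 < b₁) (hb₂ : 0 < b₂)
    (hc₁ : 0 < c₁) (hc₂ : 0 < c₂) (hh₁ : 0 < h₁) (hh₂ : 0 < h₂) (p : ℝ × ℝ) :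
    IsLGINEquilibrium b₁ b₂ c₁ c₂ h₁ h₂ p ↔
      0 < p.1 - h₁ ∧ 0 < p.2 - h₂ ∧
      (p.1 - h₁) * ((p.1 - h₁) + (1 - b₁ + h₁ + c₁ * h₂) + c₁ * (p.2 - h₂)) = b₁ * h₁ ∧
      (p.2 - h₂) * ((p.2 - h₂) + (1 - b₂ + h₂ + c₂ * h₁) + c₂ * (p.1 - h₁)) = b₂ * h₂ := by
  obtain ⟨x, y⟩ := p
  simp only [IsLGINEquilibrium, Function.IsFixedPt, LGINMap, Set.mem_prod, Set.mem_Ici,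
    Prod.mk.injEq]
  constructor
  · rintro ⟨⟨hx, hy⟩, e₁, e₂⟩
    have hD₁ : 0 < 1 + x + c₁ * y := by positivity
    have hD₂ : 0 < 1 + y + c₂ * x := by positivity
    have hx' : 0 < x := by
      have : 0 ≤ b₁ * x / (1 + x + c₁ * y) := by positivity
      linarith
    have hy' : 0 < y := by
      have : 0 ≤ b₂ * y / (1 + y + c₂ * x) := by positivity
      linarith
    have p₁ : 0 < b₁ * x / (1 + x + c₁ * y) := by positivity
    have p₂ : 0 < b₂ * y / (1 + y + c₂ * x) := by positivity
    have q₁ : b₁ * x = (x - h₁) * (1 + x + c₁ * y) := by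
      rw [← div_eq_iff hD₁.ne']; linarith
    have q₂ : b₂ * y = (y - h₂) * (1 + y + c₂ * x) := by
      rw [← div_eq_iff hD₂.ne']; linarith
    refine ⟨by linarith, by linarith, by linear_combination -q₁, by linear_combination -q₂⟩
  · rintro ⟨hu, hv, e₁, e₂⟩
    have hx : 0 < x := by linarith
    have hy : 0 < y := by linarith
    have hD₁ : 0 < 1 + x + c₁ * y := by positivity
    have hD₂ : 0 < 1 + y + c₂ * x := by positivity
    have q₁ : b₁ * x / (1 + x + c₁ * y) = x - h₁ := by
      rw [div_eq_iff hD₁.ne']; linear_combination -e₁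
    have q₂ : b₂ * y / (1 + y + c₂ * x) = y - h₂ := by
      rw [div_eq_iff hD₂.ne']; linear_combination -e₂
    exact ⟨⟨hx.le, hy.le⟩, by linarith, by linarith⟩

/-- The pair of quadratics `u (u + A + c v) = p`, `v (v + B + d u) = q` has a positive solution. -/
theorem exists_pos_solution (A B c : ℝ) {d p q : ℝ} (hd : 0 < d) (hp : 0 < p) (hq : 0 < q) :
    ∃ u v : ℝ, 0 < u ∧ 0 < v ∧ u * (u + A + c * v) = p ∧ v * (v + B + d * u) = q := by
  let U : ℝ → ℝ := fun v => (-(A + c * v) + √((A + c * v) ^ 2 + 4 * p)) / 2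
  have hUc : Continuous U := by fun_prop
  have hUpos (v : ℝ) : 0 < U v := by
    have : A + c * v < √((A + c * v) ^ 2 + 4 * p) := Real.lt_sqrt_of_sq_lt (by linarith)
    simp only [U]
    linarith
  have hUeq (v : ℝ) : U v * (U v + A + c * v) = p := by
    have := Real.sq_sqrt (show 0 ≤ (A + c * v) ^ 2 + 4 * p by positivity)
    simp only [U]
    linear_combination this / 4
  let M : ℝ := |B| + q + 1
  have hM : 1 ≤ M := by have := abs_nonneg B; simp only [M]; linarith
  have hMB : q ≤ M + B := by have := neg_abs_le B; simp only [M]; linarith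
  have hcont : ContinuousOn (fun v => v * (v + B + d * U v)) (Set.Icc 0 M) := by fun_prop
  have hmem : q ∈ Set.Icc ((fun v => v * (v + B + d * U v)) 0)
      ((fun v => v * (v + B + d * U v)) M) := by
    refine ⟨by simpa using hq.le, ?_⟩
    have h₁ : q ≤ M + B + d * U M := by have := mul_pos hd (hUpos M); linarith
    calc q ≤ M + B + d * U M := h₁
      _ ≤ M * (M + B + d * U M) := le_mul_of_one_le_left (hq.le.trans h₁) hM
  obtain ⟨v, ⟨hv₀, -⟩, hv⟩ := intermediate_value_Icc (by linarith) hcont hmem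
  refine ⟨U v, v, hUpos v, lt_of_le_of_ne hv₀ ?_, hUeq v, hv⟩
  rintro rfl
  simp only [zero_mul] at hv
  exact hq.ne hv

/-- Two positive solutions of `u (u + A + c v) = p`, `v (v + B + d u) = q` never have distinct first
coordinates, provided `A` and `B` are nonnegative or `c d ≤ 1`. -/
theorem not_lt_of_solutions {A B c d p q u v u' v' : ℝ} (hc : 0 < c) (hd : 0 < d)
    (hp : 0 < p) (hq : 0 < q) (H : (0 ≤ A ∧ 0 ≤ B) ∨ c * d ≤ 1)
    (hu : 0 < u) (hv : 0 < v) (hu' : 0 < u') (hv' : 0 < v')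
    (e₁ : u * (u + A + c * v) = p) (e₂ : v * (v + B + d * u) = q)
    (e₁' : u' * (u' + A + c * v') = p) (e₂' : v' * (v' + B + d * u') = q) : ¬ u < u' := by
  intro hlt
  have k₁ : (p + u * u') * (u' - u) = c * (u * u') * (v - v') := by
    linear_combination u * e₁' - u' * e₁
  have k₂ : (q + v * v') * (v - v') = d * (v * v') * (u' - u) := by
    linear_combination v' * e₂ - v * e₂'
  have hdu : 0 < u' - u := by linarith
  have hdv : 0 < v - v' := by
    refine pos_of_mul_pos_right (a := c * (u * u')) ?_ (by positivity)
    rw [← k₁]; positivity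
  have key : (p + u * u') * (q + v * v') = (c * (u * u')) * (d * (v * v')) := by
    refine mul_right_cancel₀ (mul_pos hdu hdv).ne' ?_
    linear_combination (q + v * v') * (v - v') * k₁ + c * (u * u') * (v - v') * k₂
  refine key.not_gt ?_
  rcases H with ⟨hA, hB⟩ | H
  · have l₁ : c * (u * v) < p + u * u' := by
      have : 0 < u * u + u * A + u * u' := by positivity
      linarith
    have l₂ : d * (u' * v') < q + v * v' := by
      have : 0 < v' * v' + v' * B + v * v' := by positivity
      linarith
    calc (c * (u * u')) * (d * (v * v')) = (c * (u * v)) * (d * (u' * v')) := by ring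
      _ < (p + u * u') * (q + v * v') := mul_lt_mul'' l₁ l₂ (by positivity) (by positivity)
  · calc (c * (u * u')) * (d * (v * v')) = (c * d) * ((u * u') * (v * v')) := by ring
      _ ≤ (u * u') * (v * v') := mul_le_of_le_one_left (by positivity) H
      _ < (p + u * u') * (q + v * v') :=
        mul_lt_mul'' (by linarith) (by linarith) (by positivity) (by positivity)

theorem theorem5 (b₁ b₂ c₁ c₂ h₁ h₂ : ℝ)
    (hb₁ : 0 < b₁) (hb₂ : 0 < b₂) (hc₁ : 0 < c₁) (hc₂ : 0 < c₂)
    (hh₁ : 0 < h₁) (hh₂ : 0 < h₂)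
    (H : (0 ≤ 1 - b₁ + h₁ + c₁ * h₂ ∧ 0 ≤ 1 - b₂ + h₂ + c₂ * h₁) ∨ c₁ * c₂ ≤ 1) :
    ∃! p : ℝ × ℝ, IsLGINEquilibrium b₁ b₂ c₁ c₂ h₁ h₂ p := by
  have hp := mul_pos hb₁ hh₁
  have hq := mul_pos hb₂ hh₂
  simp only [isLGINEquilibrium_iff hb₁ hb₂ hc₁ hc₂ hh₁ hh₂]
  refine existsUnique_of_exists_of_unique ?_ ?_
  · obtain ⟨u, v, hu, hv, e₁, e₂⟩ := exists_pos_solution (1 - b₁ + h₁ + c₁ * h₂)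
      (1 - b₂ + h₂ + c₂ * h₁) c₁ hc₂ hp hq
    exact ⟨(u + h₁, v + h₂), by simpa using ⟨hu, hv, e₁, e₂⟩⟩
  · rintro ⟨x, y⟩ ⟨x', y'⟩ ⟨hu, hv, e₁, e₂⟩ ⟨hu', hv', e₁', e₂'⟩
    dsimp only at *
    have hx : x - h₁ = x' - h₁ := le_antisymm
      (not_lt.mp (not_lt_of_solutions hc₁ hc₂ hp hq H hu' hv' hu hv e₁' e₂' e₁ e₂))
      (not_lt.mp (not_lt_of_solutions hc₁ hc₂ hp hq H hu hv hu' hv' e₁ e₂ e₁' e₂'))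
    have hy : c₁ * (y - h₂) = c₁ * (y' - h₂) := by
      refine mul_left_cancel₀ hu'.ne' ?_
      rw [hx] at e₁
      linear_combination e₁ - e₁'
    have hy' := mul_left_cancel₀ hc₁.ne' hy
    exact Prod.ext (by simpa using hx) (by simpa using hy')
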